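/- Let $C>0$, $C\neq1$, and $\xi\in\mathbb R$. On $\mathbb C^9$, with points $(M,N,S)$, $M,N,S\in\mathbb C^3$, consider the system $$\dot M=[M,W]+3[S,IS]+\xi\langle L,N\rangle[L,N],\qquad \dot N=[N,W],\qquad \dot S=[S,W-N],$$ where $[\cdot,\cdot]$ is the vector product, $\langle\cdot,\cdot\rangle$ the bilinear scalar product, $I=\mathrm{diag}(1,1,C)$, $W=I^{-1}M$ and $L=(0,0,1)$. Let $$\Pi=\{M_2=M_3=N_2=N_3=S_1=0,\ N_1=1,\ \langle S,S\rangle=\langle N,N\rangle=1,\ \langle N,S\rangle=0\}\subset\mathbb C^9,$$ which is an invariant complex surface with coordinates $(M_1,S_2,S_3)$, $S_2^2+S_3^2=1$, and let $\omega=\sqrt{3|C-1|}$. For real $k$ let $\Gamma_k\subset\Pi$ be the complex phase curve (the set of all points reached by analytic continuation in complex time, with the subspace topology) of the solution $\Phi(t,k)$ with $$\Phi(0,k):\ (M_1,S_2,S_3)=(1+\omega k,-1,0)\ \text{ if } C>1,\qquad (M_1,S_2,S_3)=(1+\omega k,0,1)\ \text{ if } C<1,$$ that is, $(M_1,S_2,S_3)=(1+\omega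 k\,\mathrm{cn}(\omega t,k),-\mathrm{dn}(\omega t,k),k\,\mathrm{sn}(\omega t,k))$ if $C>1$ and $(1+\omega k\,\mathrm{cn}(\omega t,k),k\,\mathrm{sn}(\omega t,k),\mathrm{dn}(\omega t,k))$ if $C<1$. Let $\operatorname{Re}\Gamma_1$ be the union of all real phase curves in $\Pi$ that are heteroclinic between the two equilibria of the system in $\Pi$ that are hyperbolic within the real part of $\Pi$ (these are $M_1=1$, $(S_2,S_3)=(0,\pm1)$ if $C>1$, and $M_1=1$, $(S_2,S_3)=(\mp1,0)$ if $C<1$), and let $\Omega$ be its closure. Then for every neighbourhood $U\subset\Pi$ of $\Omega$ in $\Pi$ there is $\varepsilon>0$ such that for every real $k$ with $0<|k-1|<\varepsilon$ the fundamental group of $\Gamma_k$ is generated by loops lying in $U$: there is a base point $p\in\Gamma_k\cap U$ such that $\pi_1(\Gamma_k,p)$ is generated by the classes of loops in $\Gamma_k$ based at $p$ whose image lies in $U$. -/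

import Mathlib

open Filter Topology Matrix

namespace Satellite

/-- Complexified phase space `ℂ⁹`: triples `(M, N, S)` of vectors of `ℂ³`. -/
abbrev State : Type := (Fin 3 → ℂ) × (Fin 3 → ℂ) × (Fin 3 → ℂ)

/-- The symmetry axis `L = (0, 0, 1)`. -/
def axisL : Fin 3 → ℂ := ![0, 0, 1]

/-- The inertia tensor `I = diag(1, 1, C)` applied to a vector. -/
noncomputable def inertia (C : ℝ) (x : Fin 3 → ℂ) : Fin 3 → ℂ := ![x 0, x 1, (C : ℂ) * x 2]

/-- `I⁻¹ = diag(1, 1, 1 / C)` applied to a vector. -/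
noncomputable def inertiaInv (C : ℝ) (x : Fin 3 → ℂ) : Fin 3 → ℂ := ![x 0, x 1, x 2 / (C : ℂ)]

/-- The right-hand side of the equations of rotational motion
`M' = [M, W] + 3 [S, I S] + ξ ⟨L, N⟩ [L, N]`, `N' = [N, W]`, `S' = [S, W - N]`,
where `W = I⁻¹ M` is the angular velocity. -/
noncomputable def field (C ξ : ℝ) (x : State) : State :=
  let M := x.1
  let N := x.2.1
  let S := x.2.2
  let W := inertiaInv C M
  (crossProduct M W + (3 : ℂ) • crossProduct S (inertia C S)
      + ((ξ : ℂ) * (axisL ⬝ᵥ N)) • crossProduct axisL N,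
    crossProduct N W,
    crossProduct S (W - N))

/-- The complexified symplectic leaf `⟨S, S⟩ = 1`, `⟨N, N⟩ = 1`, `⟨N, S⟩ = 0`. -/
def leaf : Set State :=
  {x | x.2.2 ⬝ᵥ x.2.2 = 1 ∧ x.2.1 ⬝ᵥ x.2.1 = 1 ∧ x.2.1 ⬝ᵥ x.2.2 = 0}

/-- The invariant manifold `M₂ = M₃ = N₂ = N₃ = S₁ = 0`, `N₁ = 1` (planar rotations). -/
def planar : Set State :=
  {x | x.1 1 = 0 ∧ x.1 2 = 0 ∧ x.2.1 1 = 0 ∧ x.2.1 2 = 0 ∧ x.2.2 0 = 0 ∧ x.2.1 0 = 1}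

/-- The invariant complex surface `Π`. -/
def surfacePi : Set State := planar ∩ leaf

/-- The point of the planar manifold with coordinates `(M₁, S₂, S₃)`. -/
def planarPoint (m s₂ s₃ : ℂ) : State := (![m, 0, 0], ![1, 0, 0], ![0, s₂, s₃])

/-- `ω = √(3 |C - 1|)`. -/
noncomputable def omega (C : ℝ) : ℝ := Real.sqrt (3 * |C - 1|)

/-- The initial value `Φ(0, k)` of the particular solution `Φ(t, k)`, which in the coordinates
`(M₁, S₂, S₃)` is `(1 + ω k cn(ωt, k), -dn(ωt, k), k sn(ωt, k))` if `C > 1` and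
`(1 + ω k cn(ωt, k), k sn(ωt, k), dn(ωt, k))` if `C < 1`; here `sn 0 = 0`, `cn 0 = dn 0 = 1`. -/
noncomputable def initialPoint (C k : ℝ) : State :=
  if 1 < C then planarPoint (1 + omega C * k) (-1) 0
  else planarPoint (1 + omega C * k) 0 1

/-- `x` and `y` lie on one holomorphic solution of `z' = v z` whose complex time runs through a
connected open set. -/
def OnCommonSolution (v : State → State) (x y : State) : Prop :=
  ∃ (D : Set ℂ) (φ : ℂ → State), IsOpen D ∧ IsPreconnected D ∧
    (∀ t ∈ D, HasDerivAt φ (v (φ t)) t) ∧ (∃ t ∈ D, φ t = x) ∧ (∃ t ∈ D, φ t = y)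

/-- The complex phase curve through `x`: all points reached from `x` by analytic continuation of
the solution of `z' = v z` that starts at `x`. -/
def phaseCurve (v : State → State) (x : State) : Set State :=
  {y | Relation.ReflTransGen (OnCommonSolution v) x y}

/-- The phase curve `Γ_k` of the particular solution `Φ(t, k)`. -/
noncomputable def Gam (C ξ k : ℝ) : Set State := phaseCurve (field C ξ) (initialPoint C k)

/-- The equilibria that are hyperbolic in the real part of `Π`: `u_± : M₁ = 1, S = (0, 0, ±1)` if
`C > 1`, and `s_± : M₁ = 1, S = (0, ∓1, 0)` if `C < 1`. -/
noncomputable def hyperbolicEquilibria (C : ℝ) : Set State :=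
  if 1 < C then {planarPoint 1 0 1, planarPoint 1 0 (-1)}
  else {planarPoint 1 (-1) 0, planarPoint 1 1 0}

/-- All nine coordinates are real. -/
def IsRealState (x : State) : Prop :=
  ∀ i, (x.1 i).im = 0 ∧ (x.2.1 i).im = 0 ∧ (x.2.2 i).im = 0

/-- `Re Γ_1`: the union of the real phase curves in `Π` that are heteroclinic, that is, that join
two different hyperbolic equilibria. -/
def reGamOne (C ξ : ℝ) : Set State :=
  {x | ∃ c : ℝ → State, (∀ t, c t ∈ surfacePi ∧ IsRealState (c t)) ∧
    (∀ t, HasDerivAt c (field C ξ (c t)) t) ∧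
    (∃ e₁ ∈ hyperbolicEquilibria C, ∃ e₂ ∈ hyperbolicEquilibria C, e₁ ≠ e₂ ∧
      Tendsto c atBot (𝓝 e₁) ∧ Tendsto c atTop (𝓝 e₂)) ∧
    ∃ t, c t = x}

/-- `Ω`, the closure of `Re Γ_1`. -/
def omegaSet (C ξ : ℝ) : Set State := closure (reGamOne C ξ)

/-- `U` is a complex neighbourhood of the set `K` in the surface `Π`. -/
def IsNeighbourhoodInPi (U K : Set State) : Prop :=
  U ⊆ surfacePi ∧ ∃ V : Set State, IsOpen V ∧ K ⊆ V ∧ V ∩ surfacePi ⊆ U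

/-- The fundamental group of the space `X` is generated by (the classes of) loops lying in `U`:
for some base point in `X ∩ U`, the loops at this point that lie in `U` generate. -/
def GeneratedByLoopsIn (X U : Set State) : Prop :=
  ∃ p : X, (p : State) ∈ U ∧
    Subgroup.closure {g : FundamentalGroup X p | ∃ γ : Path p p,
      (∀ s, (γ s : State) ∈ U) ∧ g = FundamentalGroup.fromPath (Path.Homotopic.Quotient.mk γ)} = ⊤

end Satellite
/-!
In suitable coordinates `(y, v, s)` of `Π` the system becomes Euler's system `y' = -ω v s`,
`v' = ω s y`, `s' = ω y v`, and `Γ_k` lies in the affine elliptic curve `v² + y² = k²`,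
`s² + y² = 1`. This curve is a fourfold cover of the `y`-plane, branched over `±k` and `±1` only.
Hence the homotopy that squeezes the `y`-plane onto the real segment spanned by the branch points
lifts to the curve: a square root is followed by keeping the signs of its real and imaginary parts.
The lift fixes the initial point `y = 0`, and it does not leave `Γ_k` because the complex flow
locally sweeps out the curve, so that a path on the curve cannot escape a phase curve. Every loop
is thus homotopic to one over the real segment. As `k → 1`, the compact part of the curve over this
segment shrinks to the circles `v = ±s`, `s² + y² = 1` of real points, which are the closures of
the heteroclinic solutions `tanh`, `1 / cosh` and make up `Ω`.
-/

namespace Satellite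

section Sweeping

variable {E F : Type*} [NormedAddCommGroup E] [NormedSpace ℂ E] [NormedAddCommGroup F]
  [NormedSpace ℂ F] {v : E → E} {w : F → F} {S : Set E} {T : Set F}

/-- `x` and `y` lie on one holomorphic solution of `z' = v z` that stays in `S` and whose complex
time runs through a connected open set. For `S = Set.univ` and `E = State` this is
`OnCommonSolution`. -/
def OnCommonSolutionIn (v : E → E) (S : Set E) (x y : E) : Prop :=
  ∃ (D : Set ℂ) (φ : ℂ → E), IsOpen D ∧ IsPreconnected D ∧
    (∀ t ∈ D, HasDerivAt φ (v (φ t)) t ∧ φ t ∈ S) ∧ (∃ t ∈ D, φ t = x) ∧ ∃ t ∈ D, φ t = y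

namespace OnCommonSolutionIn

theorem symm {x y : E} : OnCommonSolutionIn v S x y → OnCommonSolutionIn v S y x :=
  fun ⟨D, φ, hD, hD', hφ, hx, hy⟩ => ⟨D, φ, hD, hD', hφ, hy, hx⟩

theorem onCommonSolution {v : State → State} {S : Set State} {x y : State} :
    OnCommonSolutionIn v S x y → OnCommonSolution v x y :=
  fun ⟨D, φ, hD, hD', hφ, hx, hy⟩ => ⟨D, φ, hD, hD', fun t ht => (hφ t ht).1, hx, hy⟩

theorem map {f : E → F} {x y : E} (h : OnCommonSolutionIn v S x y) (hST : Set.MapsTo f S T)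
    (hf : ∀ (φ : ℂ → E) (t : ℂ), φ t ∈ S → HasDerivAt φ (v (φ t)) t →
      HasDerivAt (fun τ => f (φ τ)) (w (f (φ t))) t) :
    OnCommonSolutionIn w T (f x) (f y) := by
  obtain ⟨D, φ, hD, hD', hφ, ⟨t₀, ht₀, rfl⟩, t₁, ht₁, rfl⟩ := h
  exact ⟨D, fun t => f (φ t), hD, hD', fun t ht =>
    ⟨hf φ t (hφ t ht).2 (hφ t ht).1, hST (hφ t ht).2⟩, ⟨t₀, ht₀, rfl⟩, t₁, ht₁, rfl⟩

end OnCommonSolutionIn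

/-- Near each of its points, the set `S` is swept out by a holomorphic solution of `z' = v z` that
stays in `S`. A connected such set is contained in one complex phase curve. -/
def IsLocallySwept (v : E → E) (S : Set E) : Prop :=
  ∀ x ∈ S, ∀ᶠ y in 𝓝[S] x, OnCommonSolutionIn v S x y

theorem IsLocallySwept.image {f : E → F} {g : F → E} (hS : IsLocallySwept v S)
    (hgf : Set.LeftInvOn g f S) (hg : Continuous g)
    (hf : ∀ (φ : ℂ → E) (t : ℂ), φ t ∈ S → HasDerivAt φ (v (φ t)) t →
      HasDerivAt (fun τ => f (φ τ)) (w (f (φ t))) t) :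
    IsLocallySwept w (f '' S) := by
  rintro _ ⟨x, hx, rfl⟩
  have hgS : Set.MapsTo g (f '' S) S := by
    rintro _ ⟨y, hy, rfl⟩
    rwa [hgf hy]
  have hlim : Tendsto g (𝓝[f '' S] (f x)) (𝓝[S] x) := by
    have := hg.continuousWithinAt.tendsto_nhdsWithin (x := f x) hgS
    rwa [hgf hx] at this
  filter_upwards [hlim.eventually (hS x hx), self_mem_nhdsWithin] with q hq hqS
  obtain ⟨y, hy, rfl⟩ := hqS
  rw [hgf hy] at hq
  exact hq.map (Set.mapsTo_image f S) hf

theorem eqOn_of_hasDerivAt_of_starConvex {K : NNReal} (hv : LipschitzOnWith K v S)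
    {D : Set ℂ} {t₀ : ℂ} (hD : StarConvex ℝ t₀ D) {φ ψ : ℂ → E}
    (hφ : ∀ t ∈ D, HasDerivAt φ (v (φ t)) t ∧ φ t ∈ S)
    (hψ : ∀ t ∈ D, HasDerivAt ψ (v (ψ t)) t ∧ ψ t ∈ S) (h₀ : φ t₀ = ψ t₀) : Set.EqOn φ ψ D := by
  intro t ht
  have hmem : ∀ τ ∈ Set.Icc (0 : ℝ) 1, AffineMap.lineMap t₀ t τ ∈ D := fun τ hτ =>
    hD.segment_subset ht (lineMap_mem_segment ℝ t₀ t hτ)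
  have hder : ∀ χ : ℂ → E, (∀ t ∈ D, HasDerivAt χ (v (χ t)) t ∧ χ t ∈ S) →
      ∀ τ ∈ Set.Icc (0 : ℝ) 1, HasDerivAt (fun τ : ℝ => χ (AffineMap.lineMap t₀ t τ))
        ((t - t₀) • v (χ (AffineMap.lineMap t₀ t τ))) τ := fun χ hχ τ hτ =>
    (hχ _ (hmem τ hτ)).1.scomp τ AffineMap.hasDerivAt_lineMap
  have hlip : LipschitzOnWith (‖t - t₀‖₊ * K) (fun x => (t - t₀) • v x) S :=
    LipschitzOnWith.of_dist_le_mul fun x hx y hy => by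
      rw [dist_smul₀, NNReal.coe_mul, mul_assoc]
      exact mul_le_mul_of_nonneg_left (hv.dist_le_mul x hx y hy) (norm_nonneg _)
  have hIco : Set.Ico (0 : ℝ) 1 ⊆ Set.Icc 0 1 := Set.Ico_subset_Icc_self
  simpa using ODE_solution_unique_of_mem_Icc_right
    (v := fun _ x => (t - t₀) • v x) (s := fun _ => S) (fun _ _ => hlip)
    (fun τ hτ => (hder φ hφ τ hτ).continuousAt.continuousWithinAt)
    (fun τ hτ => (hder φ hφ τ (hIco hτ)).hasDerivWithinAt)
    (fun τ hτ => (hφ _ (hmem τ (hIco hτ))).2)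
    (fun τ hτ => (hder ψ hψ τ hτ).continuousAt.continuousWithinAt)
    (fun τ hτ => (hder ψ hψ τ (hIco hτ)).hasDerivWithinAt)
    (fun τ hτ => (hψ _ (hmem τ (hIco hτ))).2) (by simpa using h₀)
    (Set.right_mem_Icc.2 zero_le_one)

theorem eventuallyEq_of_hasDerivAt (hv : ContDiff ℂ 1 v) {φ ψ : ℂ → E} {t₀ : ℂ}
    (hφ : ∀ᶠ t in 𝓝 t₀, HasDerivAt φ (v (φ t)) t) (hψ : ∀ᶠ t in 𝓝 t₀, HasDerivAt ψ (v (ψ t)) t)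
    (h₀ : φ t₀ = ψ t₀) : φ =ᶠ[𝓝 t₀] ψ := by
  obtain ⟨K, s, hs, hK⟩ := hv.contDiffAt.exists_lipschitzOnWith (x := φ t₀)
  have hφs : ∀ᶠ t in 𝓝 t₀, φ t ∈ s := hφ.self_of_nhds.continuousAt hs
  have hψs : ∀ᶠ t in 𝓝 t₀, ψ t ∈ s := hψ.self_of_nhds.continuousAt (h₀ ▸ hs)
  obtain ⟨r, hr, hball⟩ :=
    Metric.eventually_nhds_iff_ball.1 ((hφ.and hφs).and (hψ.and hψs))
  exact (eqOn_of_hasDerivAt_of_starConvex hK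
    ((convex_ball t₀ r).starConvex (Metric.mem_ball_self hr)) (fun t ht => (hball t ht).1)
    (fun t ht => (hball t ht).2) h₀).eventuallyEq_of_mem (Metric.ball_mem_nhds t₀ hr)

namespace IsLocallySwept

theorem eventually_mem (hS : IsLocallySwept v S) (hv : ContDiff ℂ 1 v) {φ : ℂ → E} {t₀ : ℂ}
    (hφ : ∀ᶠ t in 𝓝 t₀, HasDerivAt φ (v (φ t)) t) (h₀ : φ t₀ ∈ S) : ∀ᶠ t in 𝓝 t₀, φ t ∈ S := by
  obtain ⟨D, ψ, hD, -, hψ, ⟨τ, hτ, hτφ⟩, -⟩ := (hS _ h₀).self_of_nhdsWithin h₀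
  have hshift : ∀ᶠ t in 𝓝 t₀, t + (τ - t₀) ∈ D :=
    (continuous_add_const (τ - t₀)).continuousAt.eventually_mem
      (hD.mem_nhds (by rwa [add_sub_cancel]))
  have hψ' : ∀ᶠ t in 𝓝 t₀, HasDerivAt (fun t => ψ (t + (τ - t₀))) (v (ψ (t + (τ - t₀)))) t :=
    hshift.mono fun t ht => (hψ _ ht).1.comp_add_const t (τ - t₀)
  filter_upwards [eventuallyEq_of_hasDerivAt hv hφ hψ' (by rw [add_sub_cancel, hτφ]), hshift]
    with t ht ht'
  exact ht ▸ (hψ _ ht').2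

theorem mapsTo_of_hasDerivAt (hS : IsLocallySwept v S) (hSc : IsClosed S) (hv : ContDiff ℂ 1 v)
    {D : Set ℂ} (hD : IsOpen D) (hD' : IsPreconnected D) {φ : ℂ → E}
    (hφ : ∀ t ∈ D, HasDerivAt φ (v (φ t)) t) (h : (D ∩ φ ⁻¹' S).Nonempty) :
    Set.MapsTo φ D S := by
  have hopen : IsOpen (D ∩ φ ⁻¹' S) := isOpen_iff_mem_nhds.2 fun t ht =>
    inter_mem (hD.mem_nhds ht.1)
      (hS.eventually_mem hv (eventually_of_mem (hD.mem_nhds ht.1) hφ) ht.2)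
  have hsub : D ⊆ D ∩ φ ⁻¹' S := by
    refine hD'.subset_of_closure_inter_subset hopen (h.mono fun t ht => ⟨ht.1, ht⟩) ?_
    rintro t ⟨htcl, htD⟩
    exact ⟨htD, hSc.closure_subset <| (hφ t htD).continuousAt.continuousWithinAt.mem_closure htcl
      fun _ hs => hs.2⟩
  exact fun t ht => (hsub ht).2

theorem phaseCurve_subset {v : State → State} {S : Set State} (hS : IsLocallySwept v S)
    (hSc : IsClosed S) (hv : ContDiff ℂ 1 v) {x : State} (hx : x ∈ S) : phaseCurve v x ⊆ S := by
  intro y hy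
  induction (hy : Relation.ReflTransGen (OnCommonSolution v) x y) with
  | refl => exact hx
  | tail _ hstep ih =>
    obtain ⟨D, φ, hD, hD', hφ, ⟨t₀, ht₀, rfl⟩, t₁, ht₁, rfl⟩ := hstep
    exact hS.mapsTo_of_hasDerivAt hSc hv hD hD' hφ ⟨t₀, ht₀, ih⟩ ht₁

theorem mem_phaseCurve_of_continuous {v : State → State} {S : Set State} (hS : IsLocallySwept v S)
    {A : Type*} [TopologicalSpace A] [PreconnectedSpace A] {γ : A → State} (hγ : Continuous γ)
    (hγS : ∀ a, γ a ∈ S) {x : State} {a : A} (ha : γ a ∈ phaseCurve v x) (b : A) :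
    γ b ∈ phaseCurve v x := by
  refine Relation.ReflTransGen.trans ha
    (PreconnectedSpace.induction₂'
      (fun a b => Relation.ReflTransGen (OnCommonSolution v) (γ a) (γ b)) (fun c => ?_)
      ⟨fun _ _ _ => Relation.ReflTransGen.trans⟩ a b)
  have hlim : Tendsto γ (𝓝 c) (𝓝[S] (γ c)) :=
    tendsto_nhdsWithin_iff.2 ⟨hγ.continuousAt, Eventually.of_forall hγS⟩
  filter_upwards [hlim.eventually (hS _ (hγS c))] with d hd
  exact ⟨.single hd.onCommonSolution, .single hd.symm.onCommonSolution⟩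

end IsLocallySwept

end Sweeping

section Euler

theorem hasDerivAt_components {𝕜 A B C : Type*} [NontriviallyNormedField 𝕜]
    [NormedAddCommGroup A] [NormedSpace 𝕜 A] [NormedAddCommGroup B] [NormedSpace 𝕜 B]
    [NormedAddCommGroup C] [NormedSpace 𝕜 C] {x : 𝕜 → A × B × C} {x' : A × B × C} {t : 𝕜}
    (h : HasDerivAt x x' t) :
    HasDerivAt (fun τ => (x τ).1) x'.1 t ∧ HasDerivAt (fun τ => (x τ).2.1) x'.2.1 t ∧
      HasDerivAt (fun τ => (x τ).2.2) x'.2.2 t :=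
  have hsnd := (ContinuousLinearMap.snd 𝕜 A (B × C)).hasFDerivAt.comp_hasDerivAt t h
  ⟨(ContinuousLinearMap.fst 𝕜 A (B × C)).hasFDerivAt.comp_hasDerivAt t h,
    (ContinuousLinearMap.fst 𝕜 B C).hasFDerivAt.comp_hasDerivAt t hsnd,
    (ContinuousLinearMap.snd 𝕜 B C).hasFDerivAt.comp_hasDerivAt t hsnd⟩

theorem exists_openPartialHomeomorph_of_hasDerivAt {f f' : ℂ → ℂ} {s : Set ℂ} {z₀ : ℂ}
    (hs : s ∈ 𝓝 z₀) (hf : ∀ z ∈ s, HasDerivAt f (f' z) z ∧ f' z ≠ 0) :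
    ∃ e : OpenPartialHomeomorph ℂ ℂ, ⇑e = f ∧ z₀ ∈ e.source ∧ e.source ⊆ s ∧
      ∀ u ∈ e.target, HasDerivAt e.symm (f' (e.symm u))⁻¹ u := by
  obtain ⟨B, hBs, hB, hz₀⟩ := mem_nhds_iff.1 hs
  have hdiff : DifferentiableOn ℂ f B := fun z hz =>
    (hf z (hBs hz)).1.differentiableAt.differentiableWithinAt
  have hstrict : HasStrictDerivAt f (f' z₀) z₀ := by
    have := (hdiff.analyticAt (hB.mem_nhds hz₀)).hasStrictDerivAt
    rwa [(hf z₀ (hBs hz₀)).1.deriv] at this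
  have hequiv := hstrict.hasStrictFDerivAt_equiv (hf z₀ (hBs hz₀)).2
  let e := (hequiv.toOpenPartialHomeomorph f).restrOpen B hB
  have hes : e.source ⊆ s := fun z hz => hBs hz.2
  refine ⟨e, rfl, ⟨hequiv.mem_toOpenPartialHomeomorph_source, hz₀⟩, hes, fun u hu => ?_⟩
  have hmem := hf _ (hes (e.map_target hu))
  exact e.hasDerivAt_symm hu hmem.2 hmem.1

theorem eventually_onCommonSolutionIn_of_ne_zero {f : ℂ → ℂ} {s : Set ℂ} {z₀ : ℂ} (hs : s ∈ 𝓝 z₀)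
    (hf : ∀ z ∈ s, DifferentiableAt ℂ f z ∧ f z ≠ 0) :
    ∀ᶠ z in 𝓝 z₀, OnCommonSolutionIn f s z₀ z := by
  obtain ⟨r, hr, hball⟩ := Metric.mem_nhds_iff.1 hs
  have hinv : DifferentiableOn ℂ (fun z => (f z)⁻¹) (Metric.ball z₀ r) := fun z hz =>
    ((hf z (hball hz)).1.inv (hf z (hball hz)).2).differentiableWithinAt
  obtain ⟨T, hT⟩ := hinv.isExactOn_ball
  obtain ⟨e, -, hz₀, hesub, hesymm⟩ := exists_openPartialHomeomorph_of_hasDerivAt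
    (Metric.ball_mem_nhds z₀ hr) fun z hz => ⟨hT z hz, inv_ne_zero (hf z (hball hz)).2⟩
  obtain ⟨ρ, hρ, hρt⟩ := Metric.isOpen_iff.1 e.open_target (e z₀) (e.map_source hz₀)
  filter_upwards [e.open_source.mem_nhds hz₀,
    (e.continuousAt hz₀).eventually_mem (Metric.ball_mem_nhds (e z₀) hρ)] with z hz hzρ
  refine ⟨Metric.ball (e z₀) ρ, e.symm, Metric.isOpen_ball, (convex_ball _ _).isPreconnected,
    fun t ht => ⟨?_, hball (hesub (e.map_target (hρt ht)))⟩,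
    ⟨e z₀, Metric.mem_ball_self hρ, e.left_inv hz₀⟩, e z, hzρ, e.left_inv hz⟩
  simpa only [inv_inv] using hesymm t (hρt ht)

theorem exists_local_sqrt {w₀ : ℂ} (hw₀ : w₀ ≠ 0) :
    ∃ σ : ℂ → ℂ, (∀ᶠ w in 𝓝 w₀, σ (w ^ 2) = w) ∧
      ∀ᶠ u in 𝓝 (w₀ ^ 2), σ u ^ 2 = u ∧ σ u ≠ 0 ∧ HasDerivAt σ (2 * σ u)⁻¹ u := by
  obtain ⟨e, he, hw, hes, hder⟩ := exists_openPartialHomeomorph_of_hasDerivAt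
    (f := fun w => w ^ 2) (f' := fun w => 2 * w) (isOpen_ne.mem_nhds hw₀) fun w hw =>
      ⟨by simpa using hasDerivAt_pow 2 w, mul_ne_zero two_ne_zero hw⟩
  have hsq : ∀ w, e w = w ^ 2 := congrFun he
  refine ⟨e.symm, ?_, ?_⟩
  · filter_upwards [e.open_source.mem_nhds hw] with w hw
    rw [← hsq, e.left_inv hw]
  · filter_upwards [e.open_target.mem_nhds (hsq w₀ ▸ e.map_source hw)] with u hu
    exact ⟨by rw [← hsq, e.right_inv hu], hes (e.map_target hu), hder u hu⟩

theorem exists_local_sqrt_quadratic {w₀ z₀ : ℂ} (hw₀ : w₀ ≠ 0) (m : ℂ) :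
    ∃ A : ℂ → ℂ,
      (∀ᶠ q : ℂ × ℂ in 𝓝 (z₀, w₀), q.2 ^ 2 - m * q.1 ^ 2 = w₀ ^ 2 - m * z₀ ^ 2 → A q.1 = q.2) ∧
      ∀ᶠ z in 𝓝 z₀, A z ^ 2 - m * z ^ 2 = w₀ ^ 2 - m * z₀ ^ 2 ∧ A z ≠ 0 ∧
        HasDerivAt A (m * z / A z) z := by
  obtain ⟨σ, hσ, hσ'⟩ := exists_local_sqrt hw₀
  set g : ℂ → ℂ := fun z => w₀ ^ 2 - m * z₀ ^ 2 + m * z ^ 2 with hg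
  have hg' : ∀ z, HasDerivAt g (m * (2 * z)) z := fun z =>
    (((hasDerivAt_pow 2 z).const_mul m).const_add _).congr_deriv (by simp)
  have hg₀ : Tendsto g (𝓝 z₀) (𝓝 (w₀ ^ 2)) := by
    simpa [hg] using (hg' z₀).continuousAt.tendsto
  refine ⟨fun z => σ (g z), ?_, ?_⟩
  · filter_upwards [(continuousAt_snd (p := (z₀, w₀))).eventually hσ] with q hq hlevel
    rw [show g q.1 = q.2 ^ 2 by linear_combination -hlevel, hq]
  · filter_upwards [hg₀.eventually hσ'] with z ⟨hsq, hne, hder⟩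
    refine ⟨by linear_combination hsq, hne, (hder.comp z (hg' z)).congr_deriv ?_⟩
    field_simp

/-- The vector field of Euler's equations `a' = p b c`, `b' = q c a`, `c' = r a b`, which are
solved by suitably scaled Jacobi elliptic functions. -/
def eulerField (p q r : ℂ) (x : ℂ × ℂ × ℂ) : ℂ × ℂ × ℂ :=
  (p * x.2.1 * x.2.2, q * x.2.2 * x.1, r * x.1 * x.2.1)

/-- The common level set through `x₀` of the quadratic first integrals `q a² - p b²`,
`r b² - q c²`, `p c² - r a²` of Euler's equations. One of the three is redundant, but together they
are symmetric under cyclic permutations of the coordinates. -/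
def eulerLevel (p q r : ℂ) (x₀ : ℂ × ℂ × ℂ) : Set (ℂ × ℂ × ℂ) :=
  {x | q * x.1 ^ 2 - p * x.2.1 ^ 2 = q * x₀.1 ^ 2 - p * x₀.2.1 ^ 2 ∧
    r * x.2.1 ^ 2 - q * x.2.2 ^ 2 = r * x₀.2.1 ^ 2 - q * x₀.2.2 ^ 2 ∧
    p * x.2.2 ^ 2 - r * x.1 ^ 2 = p * x₀.2.2 ^ 2 - r * x₀.1 ^ 2}

variable {p q r : ℂ} {x : ℂ × ℂ × ℂ}

theorem eventually_onCommonSolutionIn_eulerLevel_of_snd_ne_zero (hp : p ≠ 0)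
    (hb : x.2.1 ≠ 0) (hc : x.2.2 ≠ 0) :
    ∀ᶠ y in 𝓝[eulerLevel p q r x] x,
      OnCommonSolutionIn (eulerField p q r) (eulerLevel p q r x) x y := by
  obtain ⟨a, b, c⟩ := x
  obtain ⟨B, hBuniq, hB⟩ := exists_local_sqrt_quadratic (z₀ := a) hb (q / p)
  obtain ⟨K, hKuniq, hK⟩ := exists_local_sqrt_quadratic (z₀ := a) hc (r / p)
  have hsweep := eventually_onCommonSolutionIn_of_ne_zero (f := fun z => p * B z * K z)
    (hB.and hK) fun z ⟨⟨_, hB0, hBd⟩, _, hK0, hKd⟩ =>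
      ⟨(hBd.differentiableAt.const_mul p).mul hKd.differentiableAt,
        mul_ne_zero (mul_ne_zero hp hB0) hK0⟩
  have hlift : ∀ᶠ y in 𝓝[eulerLevel p q r (a, b, c)] (a, b, c), (y.1, B y.1, K y.1) = y := by
    have hab : Tendsto (fun y : ℂ × ℂ × ℂ => (y.1, y.2.1)) (𝓝 (a, b, c)) (𝓝 (a, b)) :=
      Continuous.tendsto (by fun_prop) (a, b, c)
    have hac : Tendsto (fun y : ℂ × ℂ × ℂ => (y.1, y.2.2)) (𝓝 (a, b, c)) (𝓝 (a, c)) :=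
      Continuous.tendsto (by fun_prop) (a, b, c)
    filter_upwards [nhdsWithin_le_nhds (hab.eventually hBuniq),
      nhdsWithin_le_nhds (hac.eventually hKuniq), self_mem_nhdsWithin] with y hyB hyK ⟨h₁, _, h₃⟩
    simp only at h₁ h₃
    rw [hyB (by field_simp; linear_combination -h₁), hyK (by field_simp; linear_combination h₃)]
  have hfst : Tendsto Prod.fst (𝓝[eulerLevel p q r (a, b, c)] (a, b, c)) (𝓝 a) :=
    continuousAt_fst.mono_left nhdsWithin_le_nhds
  have hx := hlift.self_of_nhdsWithin ⟨rfl, rfl, rfl⟩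
  filter_upwards [hlift, hfst.eventually hsweep] with y hy hay
  suffices OnCommonSolutionIn (eulerField p q r) (eulerLevel p q r (a, b, c))
      (a, B a, K a) (y.1, B y.1, K y.1) by rwa [hx, hy] at this
  refine hay.map (f := fun z => (z, B z, K z)) (fun z ⟨⟨hBz, _⟩, hKz, _⟩ => ?_)
    fun φ t ⟨⟨_, hB0, hBd⟩, _, hK0, hKd⟩ hφ => ?_
  · field_simp at hBz hKz
    exact ⟨by linear_combination -hBz,
      mul_left_cancel₀ hp (by linear_combination r * hBz - q * hKz), by linear_combination hKz⟩
  · exact hφ.prodMk (((hBd.comp t hφ).congr_deriv (by field_simp)).prodMk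
      ((hKd.comp t hφ).congr_deriv (by field_simp)))

theorem OnCommonSolutionIn.of_rotate {x y : ℂ × ℂ × ℂ}
    (h : OnCommonSolutionIn (eulerField q r p) (eulerLevel q r p (x.2.1, x.2.2, x.1))
      (x.2.1, x.2.2, x.1) (y.2.1, y.2.2, y.1)) :
    OnCommonSolutionIn (eulerField p q r) (eulerLevel p q r x) x y := by
  refine h.map (f := fun z => (z.2.2, z.1, z.2.1)) (w := eulerField p q r)
    (T := eulerLevel p q r x) (fun z hz => ?_) fun φ t _ hφ => ?_
  · obtain ⟨h₁, h₂, h₃⟩ := hz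
    exact ⟨h₃, h₁, h₂⟩
  · obtain ⟨ha, hb, hc⟩ := hasDerivAt_components hφ
    exact hc.prodMk (ha.prodMk hb)

theorem eventually_onCommonSolutionIn_eulerLevel_of_rotate
    (h : ∀ᶠ y in 𝓝[eulerLevel q r p (x.2.1, x.2.2, x.1)] (x.2.1, x.2.2, x.1),
      OnCommonSolutionIn (eulerField q r p) (eulerLevel q r p (x.2.1, x.2.2, x.1))
        (x.2.1, x.2.2, x.1) y) :
    ∀ᶠ y in 𝓝[eulerLevel p q r x] x,
      OnCommonSolutionIn (eulerField p q r) (eulerLevel p q r x) x y := by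
  have hrot : Continuous fun y : ℂ × ℂ × ℂ => (y.2.1, y.2.2, y.1) := by fun_prop
  have hlim := hrot.continuousWithinAt.tendsto_nhdsWithin (x := x) (s := eulerLevel p q r x)
    (t := eulerLevel q r p (x.2.1, x.2.2, x.1)) fun _ hy => ⟨hy.2.1, hy.2.2, hy.1⟩
  exact (hlim.eventually h).mono fun y hy => hy.of_rotate

theorem eventually_onCommonSolutionIn_eulerLevel (hp : p ≠ 0) (hq : q ≠ 0) (hr : r ≠ 0)
    (hx : x.2.1 ≠ 0 ∧ x.2.2 ≠ 0 ∨ x.2.2 ≠ 0 ∧ x.1 ≠ 0 ∨ x.1 ≠ 0 ∧ x.2.1 ≠ 0) :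
    ∀ᶠ y in 𝓝[eulerLevel p q r x] x,
      OnCommonSolutionIn (eulerField p q r) (eulerLevel p q r x) x y := by
  rcases hx with ⟨hb, hc⟩ | ⟨hc, ha⟩ | ⟨ha, hb⟩
  · exact eventually_onCommonSolutionIn_eulerLevel_of_snd_ne_zero hp hb hc
  · exact eventually_onCommonSolutionIn_eulerLevel_of_rotate
      (eventually_onCommonSolutionIn_eulerLevel_of_snd_ne_zero hq hc ha)
  · exact eventually_onCommonSolutionIn_eulerLevel_of_rotate
      (eventually_onCommonSolutionIn_eulerLevel_of_rotate
        (eventually_onCommonSolutionIn_eulerLevel_of_snd_ne_zero hr ha hb))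

end Euler

section FollowingSquareRoots

/-- The square root of `z` in the closed quadrant of `w`, if there is one: its real and imaginary
parts have the signs of those of `w`, and the absolute values dictated by `z`. -/
noncomputable def followRoot (w z : ℂ) : ℂ :=
  ⟨SignType.sign w.re * √((‖z‖ + z.re) / 2), SignType.sign w.im * √((‖z‖ - z.re) / 2)⟩

/-- One of `u` and `-u` lies in the closed quadrant of `w`, where a point `w` of an axis has this
half-axis as its quadrant. This is what makes `followRoot w (u ^ 2)` a square root of `u ^ 2`. -/
structure QuadrantCompatible (w u : ℂ) : Prop where
  re_eq_zero : w.re = 0 → u.re = 0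
  im_eq_zero : w.im = 0 → u.im = 0
  mul_nonneg : 0 ≤ w.re * w.im * (u.re * u.im)

theorem norm_sq_eq_re_sq_add_im_sq (u : ℂ) : ‖u ^ 2‖ = u.re ^ 2 + u.im ^ 2 := by
  rw [norm_pow, Complex.sq_norm, Complex.normSq_apply, sq, sq]

theorem re_sq_eq_re_sq_sub_im_sq (u : ℂ) : (u ^ 2).re = u.re ^ 2 - u.im ^ 2 := by
  rw [sq, Complex.mul_re, sq, sq]

theorem sqrt_norm_sq_add_re (u : ℂ) : √((‖u ^ 2‖ + (u ^ 2).re) / 2) = |u.re| := by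
  rw [norm_sq_eq_re_sq_add_im_sq, re_sq_eq_re_sq_sub_im_sq, ← Real.sqrt_sq_eq_abs]
  ring_nf

theorem sqrt_norm_sq_sub_re (u : ℂ) : √((‖u ^ 2‖ - (u ^ 2).re) / 2) = |u.im| := by
  rw [norm_sq_eq_re_sq_add_im_sq, re_sq_eq_re_sq_sub_im_sq, ← Real.sqrt_sq_eq_abs]
  ring_nf

theorem followRoot_sq_right (w u : ℂ) :
    followRoot w (u ^ 2) = ⟨SignType.sign w.re * |u.re|, SignType.sign w.im * |u.im|⟩ := by
  rw [followRoot, sqrt_norm_sq_add_re, sqrt_norm_sq_sub_re]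

theorem followRoot_self (w : ℂ) : followRoot w (w ^ 2) = w := by
  rw [followRoot_sq_right, sign_mul_abs, sign_mul_abs]

theorem sign_mul_abs_of_mul_nonneg {a b : ℝ} (h : 0 ≤ a * b) (h₀ : a = 0 → b = 0) :
    (SignType.sign a : ℝ) * |b| = b := by
  rcases lt_trichotomy a 0 with ha | ha | ha
  · rw [abs_of_nonpos (nonpos_of_mul_nonneg_right h ha)]
    simp [sign_neg ha]
  · simp [h₀ ha]
  · rw [abs_of_nonneg (nonneg_of_mul_nonneg_right h ha)]
    simp [sign_pos ha]

theorem QuadrantCompatible.followRoot_sq {w u : ℂ} (h : QuadrantCompatible w u) :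
    followRoot w (u ^ 2) ^ 2 = u ^ 2 := by
  have hsq : ∀ {a b : ℝ}, (a = 0 → b = 0) → ((SignType.sign a : ℝ) * |b|) ^ 2 = b ^ 2 :=
    fun {a b} hab => by
      have := sign_mul_abs_of_mul_nonneg (a := a * a) (b := b * b)
          (_root_.mul_nonneg (mul_self_nonneg a) (mul_self_nonneg b))
        fun ha => by simp [hab (mul_self_eq_zero.1 ha)]
      rw [sign_mul, abs_mul] at this
      push_cast at this
      linear_combination this
  have hre := hsq h.re_eq_zero
  have him := hsq h.im_eq_zero
  have hmul := sign_mul_abs_of_mul_nonneg h.mul_nonneg fun h₀ => by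
    rcases mul_eq_zero.1 h₀ with hw | hw
    · rw [h.re_eq_zero hw, zero_mul]
    · rw [h.im_eq_zero hw, mul_zero]
  rw [sign_mul, abs_mul] at hmul
  push_cast at hmul
  rw [followRoot_sq_right]
  apply Complex.ext
  · simp only [sq, Complex.mul_re]
    linear_combination hre - him
  · simp only [sq, Complex.mul_im]
    linear_combination 2 * hmul

theorem exists_sq_eq (z : ℂ) : ∃ u : ℂ, u ^ 2 = z :=
  IsAlgClosed.exists_pow_nat_eq z two_pos

theorem continuous_sign_mul {X : Type*} [TopologicalSpace X] {f g : X → ℝ} (hf : Continuous f)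
    (hg : Continuous g) (h : ∀ x, f x = 0 → g x = 0) :
    Continuous fun x => (SignType.sign (f x) : ℝ) * g x := by
  refine continuous_iff_continuousAt.2 fun x => ?_
  by_cases hx : f x = 0
  · have hle : ∀ y, ‖(SignType.sign (f y) : ℝ) * g y‖ ≤ |g y| := fun y => by
      rw [norm_mul, Real.norm_eq_abs, Real.norm_eq_abs]
      refine mul_le_of_le_one_left (abs_nonneg _) ?_
      cases SignType.sign (f y) <;> simp
    have hlim : Tendsto (fun y => |g y|) (𝓝 x) (𝓝 0) := by
      simpa [h x hx] using hg.abs.tendsto x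
    simpa [ContinuousAt, h x hx] using squeeze_zero_norm hle hlim
  · exact ((continuous_of_discreteTopology (f := fun s : SignType => (s : ℝ))).continuousAt.comp
      ((continuousAt_sign_of_ne_zero hx).comp hf.continuousAt)).mul hg.continuousAt

theorem continuous_complex_mk {X : Type*} [TopologicalSpace X] {f g : X → ℝ} (hf : Continuous f)
    (hg : Continuous g) : Continuous fun x => (⟨f x, g x⟩ : ℂ) :=
  Complex.equivRealProdCLM.symm.continuous.comp (hf.prodMk hg)

theorem continuous_followRoot {X : Type*} [TopologicalSpace X] {w z : X → ℂ} (hw : Continuous w)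
    (hz : Continuous z) (h : ∀ x u, u ^ 2 = z x → QuadrantCompatible (w x) u) :
    Continuous fun x => followRoot (w x) (z x) := by
  have hroot : ∀ x, ∃ u, u ^ 2 = z x ∧ QuadrantCompatible (w x) u := fun x =>
    (exists_sq_eq (z x)).imp fun u hu => ⟨hu, h x u hu⟩
  refine continuous_complex_mk (continuous_sign_mul (by fun_prop) (by fun_prop) fun x hx => ?_)
    (continuous_sign_mul (by fun_prop) (by fun_prop) fun x hx => ?_)
  · obtain ⟨u, hu, hwu⟩ := hroot x
    rw [← hu, sqrt_norm_sq_add_re, hwu.re_eq_zero hx, abs_zero]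
  · obtain ⟨u, hu, hwu⟩ := hroot x
    rw [← hu, sqrt_norm_sq_sub_re, hwu.im_eq_zero hx, abs_zero]

theorem eq_zero_of_mul_eq_zero_of_sq_le_sq {p q : ℝ} (h : p * q = 0) (hle : p ^ 2 ≤ q ^ 2) :
    p = 0 := by
  rcases mul_eq_zero.1 h with hp | hq
  · exact hp
  · exact pow_eq_zero_iff two_ne_zero |>.1 (le_antisymm (by simpa [hq] using hle) (sq_nonneg p))

end FollowingSquareRoots

section Squeezing

theorem re_mul_im_add_re_mul_im_eq_zero {w y : ℂ} {c : ℝ} (h : w ^ 2 + y ^ 2 = (c : ℂ) ^ 2) :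
    w.re * w.im + y.re * y.im = 0 := by
  have him := congrArg Complex.im h
  simp only [sq, Complex.add_im, Complex.mul_im, Complex.ofReal_re, Complex.ofReal_im] at him
  linarith

theorem re_sq_sub_im_sq_add_eq_sq {w y : ℂ} {c : ℝ} (h : w ^ 2 + y ^ 2 = (c : ℂ) ^ 2) :
    w.re ^ 2 - w.im ^ 2 + (y.re ^ 2 - y.im ^ 2) = c ^ 2 := by
  have hre := congrArg Complex.re h
  simp only [sq, Complex.add_re, Complex.mul_re, Complex.ofReal_re, Complex.ofReal_im] at hre
  linarith

/-- If `w` lies on an axis then so does `y`, hence `w` cannot leave its quadrant while `y` shrinks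
towards the real axis without crossing `±c`. -/
theorem quadrantCompatible_of_shrink {c l m : ℝ} {w y u y' : ℂ} (hc : 0 < c)
    (hw : w ^ 2 + y ^ 2 = (c : ℂ) ^ 2) (hu : u ^ 2 + y' ^ 2 = (c : ℂ) ^ 2)
    (hre : y'.re = l * y.re) (him : y'.im = m * y.im) (hl : 0 ≤ l) (hl1 : l ≤ 1) (hm : 0 ≤ m)
    (hcl : c ≤ |y.re| → c ≤ |l * y.re|) : QuadrantCompatible w u := by
  have hw₁ := re_sq_sub_im_sq_add_eq_sq hw
  have hw₂ := re_mul_im_add_re_mul_im_eq_zero hw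
  have hu₁ := re_sq_sub_im_sq_add_eq_sq hu
  have hu₂ := re_mul_im_add_re_mul_im_eq_zero hu
  rw [hre, him] at hu₁ hu₂
  refine ⟨fun h₀ => ?_, fun h₀ => ?_, ?_⟩
  · rw [h₀] at hw₁ hw₂
    have hy : y.im = 0 := (mul_eq_zero.1 (by linarith : y.re * y.im = 0)).resolve_left fun hy => by
      rw [hy] at hw₁
      nlinarith [sq_nonneg w.im, sq_nonneg y.im]
    rw [hy] at hw₁ hu₁ hu₂
    have hcy : c ^ 2 ≤ (l * y.re) ^ 2 := sq_le_sq.2 <| by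
      rw [abs_of_pos hc]
      refine hcl (abs_of_pos hc ▸ sq_le_sq.1 ?_)
      linarith [sq_nonneg w.im]
    exact eq_zero_of_mul_eq_zero_of_sq_le_sq (q := u.im) (by linarith) (by linarith)
  · rw [h₀] at hw₁ hw₂
    have hy : y.re * y.im = 0 := by linarith
    have hcy : (l * y.re) ^ 2 ≤ c ^ 2 + (m * y.im) ^ 2 := by
      rcases mul_eq_zero.1 hy with hy | hy
      · rw [hy, mul_zero]
        nlinarith [sq_nonneg (m * y.im)]
      · rw [hy] at hw₁ ⊢
        nlinarith [sq_nonneg w.re, mul_le_of_le_one_left (sq_nonneg y.re) (pow_le_one₀ hl hl1 :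
          l ^ 2 ≤ 1)]
    exact eq_zero_of_mul_eq_zero_of_sq_le_sq (q := u.re)
      (by linear_combination hu₂ - l * m * hy) (by linarith)
  · rw [show w.re * w.im * (u.re * u.im) = l * m * (y.re * y.im) ^ 2 by
      linear_combination u.re * u.im * hw₂ - y.re * y.im * hu₂]
    positivity

/-- The homotopy that flattens the plane onto the real axis, moving the points with
`R ≤ |y.re|` to `±R` and preserving the real part of the other points. -/
noncomputable def squeeze (R t : ℝ) (y : ℂ) : ℂ :=
  ⟨(1 - t + t * (R / max R |y.re|)) * y.re, (1 - t) * y.im⟩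

variable {R t : ℝ} {y : ℂ}

theorem squeeze_zero_left (R : ℝ) (y : ℂ) : squeeze R 0 y = y := by
  apply Complex.ext <;> simp [squeeze]

theorem squeeze_zero_right (R t : ℝ) : squeeze R t 0 = 0 := by
  apply Complex.ext <;> simp [squeeze]

theorem im_squeeze_one (R : ℝ) (y : ℂ) : (squeeze R 1 y).im = 0 := by simp [squeeze]

theorem div_max_mul_abs (hR : 0 < R) (y : ℝ) : R / max R |y| * |y| = min R |y| := by
  rw [div_mul_eq_mul_div, div_eq_iff (lt_max_of_lt_left hR).ne', min_mul_max]

theorem abs_re_squeeze_one_le (hR : 0 < R) (y : ℂ) : |(squeeze R 1 y).re| ≤ R := by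
  have hnonneg : 0 ≤ R / max R |y.re| := by positivity
  simp only [squeeze, sub_self, zero_add, one_mul]
  rw [abs_mul, abs_of_nonneg hnonneg, div_max_mul_abs hR]
  exact min_le_left _ _

theorem continuous_squeeze (hR : 0 < R) : Continuous fun x : ℝ × ℂ => squeeze R x.1 x.2 :=
  have hne (x : ℝ × ℂ) : max R |x.2.re| ≠ 0 := (lt_max_of_lt_left hR).ne'
  continuous_complex_mk (by fun_prop (disch := exact hne)) (by fun_prop)

theorem quadrantCompatible_of_squeeze {c : ℝ} {w u : ℂ} (hc : 0 < c) (hcR : c ≤ R)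
    (ht : t ∈ unitInterval) (hw : w ^ 2 + y ^ 2 = (c : ℂ) ^ 2)
    (hu : u ^ 2 = (c : ℂ) ^ 2 - squeeze R t y ^ 2) : QuadrantCompatible w u := by
  have hR : 0 < R := hc.trans_le hcR
  have ht' : 0 ≤ 1 - t := sub_nonneg.2 ht.2
  have hnonneg : 0 ≤ R / max R |y.re| := by positivity
  have hle : R / max R |y.re| ≤ 1 := div_le_one_of_le₀ (le_max_left _ _) (by positivity)
  have hfactor : 0 ≤ 1 - t + t * (R / max R |y.re|) := add_nonneg ht' (mul_nonneg ht.1 hnonneg)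
  refine quadrantCompatible_of_shrink hc hw (eq_sub_iff_add_eq.1 hu) rfl rfl hfactor ?_ ht'
    fun hy => ?_
  · linarith [mul_le_of_le_one_right ht.1 hle]
  · rw [abs_mul, abs_of_nonneg hfactor, add_mul, mul_assoc, div_max_mul_abs hR]
    nlinarith [le_min hcR hy, ht.1]

end Squeezing

section JacobiCurve

/-- The affine elliptic curve `v ^ 2 + y ^ 2 = a ^ 2`, `s ^ 2 + y ^ 2 = b ^ 2` of the points
`(y, v, s)`, parametrized for `(a, b) = (k, 1)` by the Jacobi functions `(k sn, k cn, dn)`. -/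
def jacobiCurve (a b : ℝ) : Set (ℂ × ℂ × ℂ) :=
  {x | x.2.1 ^ 2 + x.1 ^ 2 = (a : ℂ) ^ 2 ∧ x.2.2 ^ 2 + x.1 ^ 2 = (b : ℂ) ^ 2}

variable {a b t : ℝ} {x : ℂ × ℂ × ℂ}

theorem isClosed_jacobiCurve (a b : ℝ) : IsClosed (jacobiCurve a b) :=
  (isClosed_eq (by fun_prop) (by fun_prop)).inter (isClosed_eq (by fun_prop) (by fun_prop))

theorem eulerLevel_eq_jacobiCurve {l : ℂ} (hl : l ≠ 0) (hx : x ∈ jacobiCurve a b) :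
    eulerLevel (-l) l l x = jacobiCurve a b := by
  obtain ⟨hxa, hxb⟩ := hx
  ext z
  constructor
  · rintro ⟨hz, -, hz'⟩
    exact ⟨mul_left_cancel₀ hl (by linear_combination hz + l * hxa),
      mul_left_cancel₀ hl (by linear_combination -hz' + l * hxb)⟩
  · rintro ⟨hza, hzb⟩
    refine ⟨?_, ?_, ?_⟩
    · linear_combination l * (hza - hxa)
    · linear_combination l * (hza - hxa - hzb + hxb)
    · linear_combination l * (hxb - hzb)

theorem isLocallySwept_jacobiCurve {l : ℂ} (hl : l ≠ 0) (ha : 0 < a) (hb : 0 < b) (hab : a ≠ b) :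
    IsLocallySwept (eulerField (-l) l l) (jacobiCurve a b) := by
  intro x hx
  have ha' : (a : ℂ) ≠ 0 := mod_cast ha.ne'
  have hb' : (b : ℂ) ≠ 0 := mod_cast hb.ne'
  have hab' : (a : ℂ) ^ 2 ≠ (b : ℂ) ^ 2 := by
    norm_cast
    exact fun h => hab ((sq_eq_sq₀ ha.le hb.le).1 h)
  have hyv : x.1 ≠ 0 ∨ x.2.1 ≠ 0 := by
    by_contra! h
    exact pow_ne_zero 2 ha' (by rw [← hx.1, h.1, h.2]; ring)
  have hys : x.1 ≠ 0 ∨ x.2.2 ≠ 0 := by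
    by_contra! h
    exact pow_ne_zero 2 hb' (by rw [← hx.2, h.1, h.2]; ring)
  have hvs : x.2.1 ≠ 0 ∨ x.2.2 ≠ 0 := by
    by_contra! h
    exact hab' (by rw [← hx.1, ← hx.2, h.1, h.2])
  rw [← eulerLevel_eq_jacobiCurve hl hx]
  exact eventually_onCommonSolutionIn_eulerLevel (neg_ne_zero.2 hl) hl hl (by tauto)

/-- The lift to the elliptic curve of the homotopy `squeeze` of the `y`-plane onto the segment
spanned by the branch points `±a`, `±b`. -/
noncomputable def deform (a b t : ℝ) (x : ℂ × ℂ × ℂ) : ℂ × ℂ × ℂ :=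
  (squeeze (max a b) t x.1,
    followRoot x.2.1 ((a : ℂ) ^ 2 - squeeze (max a b) t x.1 ^ 2),
    followRoot x.2.2 ((b : ℂ) ^ 2 - squeeze (max a b) t x.1 ^ 2))

theorem deform_mem_jacobiCurve (ha : 0 < a) (hb : 0 < b) (ht : t ∈ unitInterval)
    (hx : x ∈ jacobiCurve a b) : deform a b t x ∈ jacobiCurve a b := by
  obtain ⟨u, hu⟩ := exists_sq_eq ((a : ℂ) ^ 2 - squeeze (max a b) t x.1 ^ 2)
  obtain ⟨u', hu'⟩ := exists_sq_eq ((b : ℂ) ^ 2 - squeeze (max a b) t x.1 ^ 2)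
  have hroot := (quadrantCompatible_of_squeeze ha (le_max_left a b) ht hx.1 hu).followRoot_sq
  have hroot' := (quadrantCompatible_of_squeeze hb (le_max_right a b) ht hx.2 hu').followRoot_sq
  rw [hu] at hroot
  rw [hu'] at hroot'
  exact ⟨eq_sub_iff_add_eq.1 hroot, eq_sub_iff_add_eq.1 hroot'⟩

theorem deform_eq_self_of_squeeze_eq (hx : x ∈ jacobiCurve a b)
    (h : squeeze (max a b) t x.1 = x.1) : deform a b t x = x := by
  rw [deform, h, ← hx.1, ← hx.2, add_sub_cancel_right, add_sub_cancel_right, followRoot_self,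
    followRoot_self]

theorem deform_zero (hx : x ∈ jacobiCurve a b) : deform a b 0 x = x :=
  deform_eq_self_of_squeeze_eq hx (squeeze_zero_left _ _)

theorem deform_of_fst_eq_zero (hx : x ∈ jacobiCurve a b) (h : x.1 = 0) : deform a b t x = x :=
  deform_eq_self_of_squeeze_eq hx (by rw [h, squeeze_zero_right])

theorem continuous_deform (ha : 0 < a) (hb : 0 < b) :
    Continuous fun z : unitInterval × jacobiCurve a b => deform a b z.1 z.2 := by
  have hsqueeze : Continuous fun z : unitInterval × jacobiCurve a b =>
      squeeze (max a b) z.1 (z.2 : ℂ × ℂ × ℂ).1 :=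
    (continuous_squeeze (lt_max_of_lt_left ha)).comp (f := fun z : unitInterval × jacobiCurve a b =>
      ((z.1 : ℝ), (z.2 : ℂ × ℂ × ℂ).1)) (by fun_prop)
  refine hsqueeze.prodMk ((continuous_followRoot (by fun_prop) (by fun_prop)
    fun z u hu => ?_).prodMk (continuous_followRoot (by fun_prop) (by fun_prop) fun z u hu => ?_))
  · exact quadrantCompatible_of_squeeze ha (le_max_left a b) z.1.2 z.2.2.1 hu
  · exact quadrantCompatible_of_squeeze hb (le_max_right a b) z.1.2 z.2.2.2 hu

/-- The part of the elliptic curve over the real segment spanned by the branch points `±a`, `±b`: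
the compact graph onto which `deform` retracts the curve. -/
def realSkeleton (a b : ℝ) : Set (ℂ × ℂ × ℂ) :=
  {x ∈ jacobiCurve a b | x.1.im = 0 ∧ |x.1.re| ≤ max a b}

theorem deform_one_mem_realSkeleton (ha : 0 < a) (hb : 0 < b) (hx : x ∈ jacobiCurve a b) :
    deform a b 1 x ∈ realSkeleton a b :=
  ⟨deform_mem_jacobiCurve ha hb unitInterval.one_mem hx, im_squeeze_one _ _,
    abs_re_squeeze_one_le (lt_max_of_lt_left ha) _⟩

end JacobiCurve

section FundamentalGroup

/-- A homotopy of the space that fixes the base point carries each loop to a homotopic one. -/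
theorem generatedByLoopsIn_of_homotopyRel {X U : Set State} {p : X} {f : C(X, X)}
    (H : (ContinuousMap.id X).HomotopyRel f {p}) (hf : ∀ x, (f x : State) ∈ U) :
    GeneratedByLoopsIn X U := by
  have hfp : f p = p := (H.fst_eq_snd (Set.mem_singleton p)).symm
  refine ⟨p, hfp ▸ hf p, eq_top_iff.2 fun g _ => Subgroup.subset_closure ?_⟩
  obtain ⟨γ, hγ⟩ := Quotient.exists_rep (FundamentalGroup.toPath g)
  let γ' : Path p p := (γ.map f.continuous).cast hfp.symm hfp.symm
  have hom : Path.Homotopic γ γ' :=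
    ⟨{ toFun := fun z => H (z.1, γ z.2)
       map_zero_left := fun s => H.apply_zero _
       map_one_left := fun s => H.apply_one _
       prop' := by
        rintro t s (rfl | rfl)
        · simpa using H.eq_fst t (Set.mem_singleton p)
        · simpa using H.eq_fst t (Set.mem_singleton p) }⟩
  refine ⟨γ', fun s => hf (γ s), ?_⟩
  rw [Path.Homotopic.Quotient.eq.2 hom.symm]
  exact congrArg FundamentalGroup.fromPath hγ.symm

end FundamentalGroup

section PlanarCoordinates

/-- The chart of `Π` in which the equations of motion become symmetric, see `hasDerivAt_embed`:
the point `(y, v, s)` has `M₁ = 1 + ω v`, and `S₂ + i S₃` is `s + i y` if `C > 1` and `y - i s` if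
`C < 1`. -/
noncomputable def embed (C : ℝ) (x : ℂ × ℂ × ℂ) : State :=
  if 1 < C then planarPoint (1 + omega C * x.2.1) x.2.2 x.1
  else planarPoint (1 + omega C * x.2.1) x.1 (-x.2.2)

/-- The coordinates of the chart `embed`, extended to all of `State`. -/
noncomputable def coords (C : ℝ) (x : State) : ℂ × ℂ × ℂ :=
  if 1 < C then (x.2.2 2, (x.1 0 - 1) / omega C, x.2.2 1)
  else (x.2.2 1, (x.1 0 - 1) / omega C, -x.2.2 2)

theorem omega_pos {C : ℝ} (hC : C ≠ 1) : 0 < omega C :=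
  Real.sqrt_pos.2 (mul_pos three_pos (abs_pos.2 (sub_ne_zero.2 hC)))

theorem omega_sq (C : ℝ) : omega C ^ 2 = 3 * |C - 1| :=
  Real.sq_sqrt (by positivity)

theorem initialPoint_eq_embed (C k : ℝ) : initialPoint C k = embed C (0, k, -1) := by
  simp only [initialPoint, embed, neg_neg]

theorem leftInverse_coords_embed {C : ℝ} (hC : C ≠ 1) :
    Function.LeftInverse (coords C) (embed C) := fun x => by
  have hω : (omega C : ℂ) ≠ 0 := mod_cast (omega_pos hC).ne'
  by_cases h : 1 < C <;> simp [coords, embed, h, planarPoint, hω]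

theorem continuous_coords (C : ℝ) : Continuous (coords C) := by
  unfold coords
  split_ifs <;> fun_prop

theorem continuous_planarPoint {X : Type*} [TopologicalSpace X] {m s₂ s₃ : X → ℂ}
    (hm : Continuous m) (hs₂ : Continuous s₂) (hs₃ : Continuous s₃) :
    Continuous fun x => planarPoint (m x) (s₂ x) (s₃ x) := by
  unfold planarPoint
  fun_prop

theorem continuous_embed (C : ℝ) : Continuous (embed C) := by
  unfold embed
  split_ifs <;> apply continuous_planarPoint <;> fun_prop

theorem isClosedEmbedding_embed {C : ℝ} (hC : C ≠ 1) : IsClosedEmbedding (embed C) :=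
  (leftInverse_coords_embed hC).isClosedEmbedding (continuous_coords C) (continuous_embed C)

theorem planarPoint_mem_surfacePi {m s₂ s₃ : ℂ} (h : s₂ ^ 2 + s₃ ^ 2 = 1) :
    planarPoint m s₂ s₃ ∈ surfacePi := by
  simp [surfacePi, planar, leaf, planarPoint, Matrix.vec3_dotProduct, ← sq, h]

theorem embed_mem_surfacePi (C : ℝ) {a : ℝ} {x : ℂ × ℂ × ℂ} (hx : x ∈ jacobiCurve a 1) :
    embed C x ∈ surfacePi := by
  have h := hx.2
  rw [Complex.ofReal_one, one_pow] at h
  unfold embed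
  split_ifs
  · exact planarPoint_mem_surfacePi h
  · exact planarPoint_mem_surfacePi (by linear_combination h)

theorem contDiff_field (C ξ : ℝ) : ContDiff ℂ 1 (field C ξ) := by
  unfold field
  simp only [cross_apply, inertia, inertiaInv, axisL, dotProduct, Fin.sum_univ_three,
    div_eq_mul_inv]
  refine ContDiff.prodMk ?_ (ContDiff.prodMk ?_ ?_) <;>
    refine contDiff_pi.2 fun i => ?_ <;> fin_cases i <;> dsimp <;> fun_prop

theorem field_planarPoint (C ξ : ℝ) (m s₂ s₃ : ℂ) :
    field C ξ (planarPoint m s₂ s₃) =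
      (![3 * (C - 1) * s₂ * s₃, 0, 0], 0, ![0, s₃ * (m - 1), -s₂ * (m - 1)]) := by
  have hM : 3 * (s₂ * (C * s₃) - s₃ * s₂) = 3 * (C - 1) * s₂ * s₃ := by ring
  unfold field planarPoint
  refine Prod.ext ?_ (Prod.ext ?_ ?_) <;> funext i <;> fin_cases i <;>
    simp [cross_apply, inertia, inertiaInv, axisL, dotProduct, Fin.sum_univ_three, hM]

variable {𝕜 : Type*} [NontriviallyNormedField 𝕜] [NormedAlgebra 𝕜 ℂ]

theorem hasDerivAt_planarPoint {C : ℝ} (ξ : ℝ) {m s₂ s₃ : 𝕜 → ℂ} {t : 𝕜}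
    (hm : HasDerivAt m (3 * (C - 1) * s₂ t * s₃ t) t) (hs₂ : HasDerivAt s₂ (s₃ t * (m t - 1)) t)
    (hs₃ : HasDerivAt s₃ (-(s₂ t * (m t - 1))) t) :
    HasDerivAt (fun τ => planarPoint (m τ) (s₂ τ) (s₃ τ))
      (field C ξ (planarPoint (m t) (s₂ t) (s₃ t))) t := by
  rw [field_planarPoint]
  unfold planarPoint
  refine HasDerivAt.prodMk ?_ (HasDerivAt.prodMk (hasDerivAt_const t _) ?_) <;>
    refine hasDerivAt_pi.2 fun i => ?_ <;> fin_cases i <;> simp [hasDerivAt_const, *]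

theorem hasDerivAt_embed (C ξ : ℝ) {x : 𝕜 → ℂ × ℂ × ℂ} {t : 𝕜}
    (hx : HasDerivAt x (eulerField (-omega C) (omega C) (omega C) (x t)) t) :
    HasDerivAt (fun τ => embed C (x τ)) (field C ξ (embed C (x t))) t := by
  obtain ⟨hy, hv, hs⟩ := hasDerivAt_components hx
  have hm := (hv.const_mul (omega C : ℂ)).const_add 1
  have hω : (omega C : ℂ) ^ 2 = 3 * |C - 1| := mod_cast omega_sq C
  simp only [eulerField] at hy hv hs hm
  by_cases h : 1 < C
  · rw [abs_of_pos (sub_pos.2 h)] at hω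
    push_cast at hω
    simp only [embed, if_pos h]
    exact hasDerivAt_planarPoint ξ
      (hm.congr_deriv (by linear_combination (x t).1 * (x t).2.2 * hω))
      (hs.congr_deriv (by ring)) (hy.congr_deriv (by ring))
  · rw [abs_of_nonpos (sub_nonpos.2 (not_lt.1 h))] at hω
    push_cast at hω
    simp only [embed, if_neg h]
    exact hasDerivAt_planarPoint ξ
      (hm.congr_deriv (by linear_combination (x t).1 * (x t).2.2 * hω))
      (hy.congr_deriv (by ring)) (hs.neg.congr_deriv (by ring))

end PlanarCoordinates

section PhaseCurve

variable {C ξ k : ℝ}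

theorem isLocallySwept_embed_image_jacobiCurve (hC : C ≠ 1) (hk : 0 < k) (hk1 : k ≠ 1) :
    IsLocallySwept (field C ξ) (embed C '' jacobiCurve k 1) :=
  (isLocallySwept_jacobiCurve (mod_cast (omega_pos hC).ne') hk one_pos hk1).image
    (fun x _ => leftInverse_coords_embed hC x) (continuous_coords C)
    fun _ _ _ hφ => hasDerivAt_embed C ξ hφ

theorem zero_coe_neg_one_mem_jacobiCurve (k : ℝ) : ((0, k, -1) : ℂ × ℂ × ℂ) ∈ jacobiCurve k 1 := by
  simp [jacobiCurve]

theorem gam_subset_embed_image_jacobiCurve (hC : C ≠ 1) (hk : 0 < k) (hk1 : k ≠ 1) :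
    Gam C ξ k ⊆ embed C '' jacobiCurve k 1 :=
  (isLocallySwept_embed_image_jacobiCurve hC hk hk1).phaseCurve_subset
    ((isClosedEmbedding_embed hC).isClosedMap _ (isClosed_jacobiCurve k 1)) (contDiff_field C ξ)
    ⟨_, zero_coe_neg_one_mem_jacobiCurve k, (initialPoint_eq_embed C k).symm⟩

theorem coords_mem_jacobiCurve (hC : C ≠ 1) (hk : 0 < k) (hk1 : k ≠ 1) {x : State}
    (hx : x ∈ Gam C ξ k) : coords C x ∈ jacobiCurve k 1 := by
  obtain ⟨z, hz, rfl⟩ := gam_subset_embed_image_jacobiCurve hC hk hk1 hx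
  rwa [leftInverse_coords_embed hC]

theorem embed_coords_of_mem_gam (hC : C ≠ 1) (hk : 0 < k) (hk1 : k ≠ 1) {x : State}
    (hx : x ∈ Gam C ξ k) : embed C (coords C x) = x := by
  obtain ⟨z, -, rfl⟩ := gam_subset_embed_image_jacobiCurve hC hk hk1 hx
  rw [leftInverse_coords_embed hC]

/-- The homotopy that `deform` induces on the phase curve. -/
noncomputable def gamDeform (C k : ℝ) (t : ℝ) (x : State) : State :=
  embed C (deform k 1 t (coords C x))

theorem gamDeform_zero (hC : C ≠ 1) (hk : 0 < k) (hk1 : k ≠ 1) {x : State} (hx : x ∈ Gam C ξ k) :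
    gamDeform C k 0 x = x := by
  rw [gamDeform, deform_zero (coords_mem_jacobiCurve hC hk hk1 hx),
    embed_coords_of_mem_gam hC hk hk1 hx]

theorem gamDeform_initialPoint (hC : C ≠ 1) (k t : ℝ) :
    gamDeform C k t (initialPoint C k) = initialPoint C k := by
  rw [gamDeform, initialPoint_eq_embed, leftInverse_coords_embed hC,
    deform_of_fst_eq_zero (zero_coe_neg_one_mem_jacobiCurve k) rfl]

theorem continuous_gamDeform (hC : C ≠ 1) (hk : 0 < k) (hk1 : k ≠ 1) :
    Continuous fun z : unitInterval × Gam C ξ k => gamDeform C k z.1 z.2 := by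
  have hcoords : Continuous fun x : Gam C ξ k =>
      (⟨coords C x, coords_mem_jacobiCurve hC hk hk1 x.2⟩ : jacobiCurve k 1) :=
    ((continuous_coords C).comp continuous_subtype_val).subtype_mk _
  exact (continuous_embed C).comp
    ((continuous_deform hk one_pos).comp (continuous_id.prodMap hcoords))

theorem gamDeform_mem_gam (hC : C ≠ 1) (hk : 0 < k) (hk1 : k ≠ 1) {x : State}
    (hx : x ∈ Gam C ξ k) (t : unitInterval) : gamDeform C k t x ∈ Gam C ξ k := by
  have hpath : Continuous fun τ : unitInterval => gamDeform C k τ x :=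
    (continuous_gamDeform hC hk hk1).curry_left (y := (⟨x, hx⟩ : Gam C ξ k))
  refine (isLocallySwept_embed_image_jacobiCurve hC hk hk1).mem_phaseCurve_of_continuous
    (x := initialPoint C k) hpath (fun τ => ?_) (a := 0) ?_ t
  · exact Set.mem_image_of_mem _
      (deform_mem_jacobiCurve hk one_pos τ.2 (coords_mem_jacobiCurve hC hk hk1 hx))
  · rw [Set.Icc.coe_zero, gamDeform_zero hC hk hk1 hx]
    exact hx

theorem generatedByLoopsIn_gam {U : Set State} (hC : C ≠ 1) (hk : 0 < k) (hk1 : k ≠ 1)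
    (hU : embed C '' realSkeleton k 1 ⊆ U) : GeneratedByLoopsIn (Gam C ξ k) U := by
  let p : Gam C ξ k := ⟨initialPoint C k, Relation.ReflTransGen.refl⟩
  let h (z : unitInterval × Gam C ξ k) : Gam C ξ k :=
    ⟨gamDeform C k z.1 z.2, gamDeform_mem_gam hC hk hk1 z.2.2 z.1⟩
  have hh : Continuous h := (continuous_gamDeform hC hk hk1).subtype_mk _
  let f : C(Gam C ξ k, Gam C ξ k) := ⟨fun x => h (1, x), hh.comp (Continuous.prodMk_right 1)⟩
  let H : (ContinuousMap.id (Gam C ξ k)).HomotopyRel f {p} :=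
    { toFun := h
      continuous_toFun := hh
      map_zero_left := fun x => Subtype.ext (gamDeform_zero hC hk hk1 x.2)
      map_one_left := fun _ => rfl
      prop' := by
        rintro t _ rfl
        exact Subtype.ext (gamDeform_initialPoint hC k t) }
  exact generatedByLoopsIn_of_homotopyRel H fun x => hU
    ⟨_, deform_one_mem_realSkeleton hk one_pos (coords_mem_jacobiCurve hC hk hk1 x.2), rfl⟩

end PhaseCurve

section Heteroclinic

theorem tendsto_inv_cosh_atTop : Tendsto (fun x => (Real.cosh x)⁻¹) atTop (𝓝 0) := by
  have hle (x : ℝ) : (Real.cosh x)⁻¹ ≤ 2 * Real.exp (-x) := by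
    rw [Real.exp_neg, ← div_eq_mul_inv, inv_le_comm₀ (Real.cosh_pos x) (by positivity), inv_div,
      Real.cosh_eq]
    linarith [Real.exp_pos (-x)]
  refine squeeze_zero (fun x => (inv_pos.2 (Real.cosh_pos x)).le) hle ?_
  simpa using Real.tendsto_exp_neg_atTop_nhds_zero.const_mul 2

theorem tendsto_inv_cosh_atBot : Tendsto (fun x => (Real.cosh x)⁻¹) atBot (𝓝 0) := by
  simpa [Function.comp_def] using tendsto_inv_cosh_atTop.comp tendsto_neg_atBot_atTop

theorem tendsto_tanh_atTop : Tendsto Real.tanh atTop (𝓝 1) := by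
  have htanh (x : ℝ) : Real.tanh x = 1 - Real.exp (-x) * (Real.cosh x)⁻¹ := by
    have hcosh := (Real.cosh_pos x).ne'
    rw [Real.tanh_eq_sinh_div_cosh, ← Real.cosh_sub_sinh]
    field_simp
    ring
  rw [funext htanh]
  simpa using (Real.tendsto_exp_neg_atTop_nhds_zero.mul tendsto_inv_cosh_atTop).const_sub 1

theorem tendsto_tanh_atBot : Tendsto Real.tanh atBot (𝓝 (-1)) := by
  simpa [Function.comp_def] using (tendsto_tanh_atTop.comp tendsto_neg_atBot_atTop).neg

theorem hasDerivAt_tanh (x : ℝ) : HasDerivAt Real.tanh ((Real.cosh x)⁻¹ ^ 2) x := by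
  have hcosh := (Real.cosh_pos x).ne'
  rw [funext Real.tanh_eq_sinh_div_cosh]
  refine ((Real.hasDerivAt_sinh x).div (Real.hasDerivAt_cosh x) hcosh).congr_deriv ?_
  field_simp
  linear_combination Real.cosh_sq_sub_sinh_sq x

theorem hasDerivAt_inv_cosh (x : ℝ) :
    HasDerivAt (fun x => (Real.cosh x)⁻¹) (-(Real.tanh x * (Real.cosh x)⁻¹)) x := by
  have hcosh := (Real.cosh_pos x).ne'
  refine ((Real.hasDerivAt_cosh x).inv hcosh).congr_deriv ?_
  rw [Real.tanh_eq_sinh_div_cosh]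
  field_simp

theorem inv_cosh_sq_add_tanh_sq (x : ℝ) : (Real.cosh x)⁻¹ ^ 2 + Real.tanh x ^ 2 = 1 := by
  have hcosh := (Real.cosh_pos x).ne'
  rw [Real.tanh_eq_sinh_div_cosh]
  field_simp
  linear_combination -Real.cosh_sq_sub_sinh_sq x

/-- The four heteroclinic solutions, for `d, e = ±1`, on the curve `jacobiCurve 1 1`; this is the
limit of the Jacobi functions at modulus `1`. -/
noncomputable def heteroclinic (l d e t : ℝ) : ℂ × ℂ × ℂ :=
  ((d * Real.tanh (l * t) : ℝ), (e * (Real.cosh (l * t))⁻¹ : ℝ),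
    (-(d * e) * (Real.cosh (l * t))⁻¹ : ℝ))

variable {l d e t : ℝ}

theorem heteroclinic_mem_jacobiCurve (hd : d ^ 2 = 1) (he : e ^ 2 = 1) :
    heteroclinic l d e t ∈ jacobiCurve 1 1 := by
  have h := inv_cosh_sq_add_tanh_sq (l * t)
  constructor <;> simp only [heteroclinic, Complex.ofReal_one, one_pow] <;> norm_cast <;>
    simp only [mul_pow, neg_sq, hd, he, h, one_mul]

theorem hasDerivAt_heteroclinic (hd : d ^ 2 = 1) (he : e ^ 2 = 1) :
    HasDerivAt (heteroclinic l d e) (eulerField (-l) l l (heteroclinic l d e t)) t := by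
  have hmul : HasDerivAt (fun τ => l * τ) l t := by simpa using (hasDerivAt_id t).const_mul l
  have htanh := (hasDerivAt_tanh (l * t)).comp t hmul
  have hcosh := (hasDerivAt_inv_cosh (l * t)).comp t hmul
  refine ((htanh.const_mul d).ofReal_comp.congr_deriv ?_).prodMk
    (((hcosh.const_mul e).ofReal_comp.congr_deriv ?_).prodMk
      ((hcosh.const_mul (-(d * e))).ofReal_comp.congr_deriv ?_))
  all_goals
    simp only [heteroclinic]
    norm_cast
  · linear_combination -(d * l * (Real.cosh (l * t))⁻¹ ^ 2) * he
  · linear_combination e * l * Real.tanh (l * t) * (Real.cosh (l * t))⁻¹ * hd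
  · ring

theorem tendsto_heteroclinic {y : ℝ} {f : Filter ℝ}
    (htanh : Tendsto (fun t => Real.tanh (l * t)) f (𝓝 y))
    (hcosh : Tendsto (fun t => (Real.cosh (l * t))⁻¹) f (𝓝 0)) :
    Tendsto (heteroclinic l d e) f (𝓝 ((d * y : ℝ), 0, 0)) := by
  have hy := (htanh.const_mul d).ofReal
  have hv := (hcosh.const_mul e).ofReal
  have hs := (hcosh.const_mul (-(d * e))).ofReal
  rw [mul_zero, Complex.ofReal_zero] at hv hs
  exact hy.prodMk_nhds (hv.prodMk_nhds hs)

theorem tendsto_heteroclinic_atTop (hl : 0 < l) :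
    Tendsto (heteroclinic l d e) atTop (𝓝 (d, 0, 0)) := by
  have hmul : Tendsto (fun t => l * t) atTop atTop := tendsto_id.const_mul_atTop hl
  simpa using tendsto_heteroclinic (d := d) (e := e) (tendsto_tanh_atTop.comp hmul)
    (tendsto_inv_cosh_atTop.comp hmul)

theorem tendsto_heteroclinic_atBot (hl : 0 < l) :
    Tendsto (heteroclinic l d e) atBot (𝓝 ((-d : ℝ), 0, 0)) := by
  have hmul : Tendsto (fun t => l * t) atBot atBot := tendsto_id.const_mul_atBot hl
  simpa using tendsto_heteroclinic (d := d) (e := e) (tendsto_tanh_atBot.comp hmul)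
    (tendsto_inv_cosh_atBot.comp hmul)

theorem exists_sq_eq_one_mul_eq_of_sq_eq_sq {a b : ℝ} (h : a ^ 2 = b ^ 2) :
    ∃ e : ℝ, e ^ 2 = 1 ∧ e * a = b := by
  rcases sq_eq_sq_iff_eq_or_eq_neg.1 h with rfl | rfl
  · exact ⟨1, by norm_num, one_mul a⟩
  · exact ⟨-1, by norm_num, by ring⟩

theorem exists_heteroclinic_eq {y v s : ℝ} (hl : l ≠ 0) (hv : v ^ 2 + y ^ 2 = 1)
    (hs : s ^ 2 + y ^ 2 = 1) (hy : y ^ 2 < 1) :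
    ∃ d e t, d ^ 2 = 1 ∧ e ^ 2 = 1 ∧ heteroclinic l d e t = (↑y, ↑v, ↑s) := by
  obtain ⟨e, he, hev⟩ := exists_sq_eq_one_mul_eq_of_sq_eq_sq (sq_abs v)
  obtain ⟨d, hd, hdv⟩ := exists_sq_eq_one_mul_eq_of_sq_eq_sq (by linarith : v ^ 2 = (-s) ^ 2)
  have hdy : (d * y) ^ 2 = y ^ 2 := by rw [mul_pow, hd, one_mul]
  have hmem : d * y ∈ Set.Ioo (-1) 1 := abs_lt.1 ((sq_lt_one_iff_abs_lt_one _).1 (hdy.trans_lt hy))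
  have hcosh : (Real.cosh (Real.artanh (d * y)))⁻¹ = |v| := by
    rw [Real.cosh_artanh hmem, one_div, inv_inv, hdy, ← Real.sqrt_sq_eq_abs]
    congr 1
    linarith
  refine ⟨d, e, Real.artanh (d * y) / l, hd, he, ?_⟩
  rw [heteroclinic, mul_div_cancel₀ _ hl, Real.tanh_artanh hmem, hcosh, ← mul_assoc, ← sq, hd,
    one_mul, hev, neg_mul, mul_assoc, hev, hdv, neg_neg]

variable {C : ℝ}

theorem isRealState_embed (C y v s : ℝ) : IsRealState (embed C (y, v, s)) := by
  intro i
  unfold embed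
  split_ifs <;> fin_cases i <;> simp [planarPoint]

theorem embed_mem_hyperbolicEquilibria (C : ℝ) (hd : d ^ 2 = 1) :
    embed C (d, 0, 0) ∈ hyperbolicEquilibria C := by
  unfold embed hyperbolicEquilibria
  rcases sq_eq_sq_iff_eq_or_eq_neg.1 (hd.trans (one_pow 2).symm) with rfl | rfl <;>
    split_ifs <;> simp

theorem embed_heteroclinic_mem_reGamOne (hC : C ≠ 1) (ξ : ℝ) (hd : d ^ 2 = 1) (he : e ^ 2 = 1) :
    embed C (heteroclinic (omega C) d e t) ∈ reGamOne C ξ := by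
  have hne : embed C ((-d : ℝ), 0, 0) ≠ embed C (d, 0, 0) := fun h => by
    have h₁ := (leftInverse_coords_embed hC).injective h
    simp only [Prod.mk.injEq, Complex.ofReal_inj, and_true, neg_eq_self] at h₁
    norm_num [h₁] at hd
  refine ⟨fun t => embed C (heteroclinic (omega C) d e t), fun t => ⟨?_, isRealState_embed C _ _ _⟩,
    fun t => hasDerivAt_embed C ξ (hasDerivAt_heteroclinic hd he),
    ⟨_, embed_mem_hyperbolicEquilibria C (by rwa [neg_sq]), _,
      embed_mem_hyperbolicEquilibria C hd, hne, ?_, ?_⟩, t, rfl⟩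
  · exact embed_mem_surfacePi C (heteroclinic_mem_jacobiCurve hd he)
  · exact ((continuous_embed C).tendsto _).comp (tendsto_heteroclinic_atBot (omega_pos hC))
  · exact ((continuous_embed C).tendsto _).comp (tendsto_heteroclinic_atTop (omega_pos hC))

theorem embed_mem_omegaSet (hC : C ≠ 1) (ξ : ℝ) {y v s : ℝ} (hv : v ^ 2 + y ^ 2 = 1)
    (hs : s ^ 2 + y ^ 2 = 1) : embed C (y, v, s) ∈ omegaSet C ξ := by
  rcases (by linarith [sq_nonneg v] : y ^ 2 ≤ 1).lt_or_eq with hy | hy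
  · obtain ⟨d, e, t, hd, he, ht⟩ := exists_heteroclinic_eq (omega_pos hC).ne' hv hs hy
    exact ht ▸ subset_closure (embed_heteroclinic_mem_reGamOne hC ξ hd he)
  · have hv₀ : v = 0 := pow_eq_zero_iff two_ne_zero |>.1 (by linarith)
    have hs₀ : s = 0 := pow_eq_zero_iff two_ne_zero |>.1 (by linarith)
    rw [hv₀, hs₀, Complex.ofReal_zero]
    exact mem_closure_of_tendsto
      (((continuous_embed C).tendsto _).comp (tendsto_heteroclinic_atTop (omega_pos hC)))
      (Eventually.of_forall fun t => embed_heteroclinic_mem_reGamOne hC ξ hy (one_pow 2))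

theorem im_eq_zero_of_sq_add_sq_eq_sq {w : ℂ} {c y : ℝ} (h : w ^ 2 + (y : ℂ) ^ 2 = (c : ℂ) ^ 2)
    (hy : y ^ 2 ≤ c ^ 2) : w.im = 0 := by
  have hre := re_sq_sub_im_sq_add_eq_sq h
  have him := re_mul_im_add_re_mul_im_eq_zero h
  rw [Complex.ofReal_re, Complex.ofReal_im] at hre him
  exact eq_zero_of_mul_eq_zero_of_sq_le_sq (q := w.re) (by linarith) (by linarith)

theorem embed_image_realSkeleton_subset_omegaSet (hC : C ≠ 1) (ξ : ℝ) :
    embed C '' realSkeleton 1 1 ⊆ omegaSet C ξ := by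
  rintro _ ⟨⟨y, v, s⟩, ⟨⟨hv, hs⟩, him, hre⟩, rfl⟩
  lift y to ℝ using him
  have hy : y ^ 2 ≤ 1 ^ 2 := sq_le_sq.2 (by simpa using hre)
  lift v to ℝ using im_eq_zero_of_sq_add_sq_eq_sq hv hy
  lift s to ℝ using im_eq_zero_of_sq_add_sq_eq_sq hs hy
  dsimp only at hv hs
  rw [Complex.ofReal_one, one_pow] at hv hs
  exact embed_mem_omegaSet hC ξ (mod_cast hv) (mod_cast hs)

end Heteroclinic

section NearModulusOne

theorem eventually_forall_mem_of_isCompact {X Y : Type*} [TopologicalSpace X] [T2Space X]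
    [TopologicalSpace Y] {K : Set (X × Y)} (hK : IsCompact K) {W : Set Y} (hW : IsOpen W) {a : X}
    (h : ∀ y, (a, y) ∈ K → y ∈ W) : ∀ᶠ x in 𝓝 a, ∀ y, (x, y) ∈ K → y ∈ W := by
  have hbad : IsClosed (Prod.fst '' (K \ Prod.snd ⁻¹' W)) :=
    ((hK.diff (hW.preimage continuous_snd)).image continuous_fst).isClosed
  have ha : a ∉ Prod.fst '' (K \ Prod.snd ⁻¹' W) := by
    rintro ⟨⟨_, y⟩, ⟨hyK, hyW⟩, rfl⟩
    exact hyW (h y hyK)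
  filter_upwards [hbad.isOpen_compl.mem_nhds ha] with x hx y hy
  by_contra hyW
  exact hx ⟨(x, y), ⟨hy, hyW⟩, rfl⟩

theorem norm_le_of_sq_add_sq_eq_sq {w y c : ℂ} {R : ℝ} (h : w ^ 2 + y ^ 2 = c ^ 2) (hy : ‖y‖ ≤ R)
    (hc : ‖c‖ ≤ R) : ‖w‖ ≤ 2 * R := by
  have hle : ‖w‖ ^ 2 ≤ ‖c‖ ^ 2 + ‖y‖ ^ 2 := by
    rw [← norm_pow, ← norm_pow, ← norm_pow, eq_sub_of_add_eq h]
    exact norm_sub_le _ _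
  nlinarith [norm_nonneg w, norm_nonneg y, norm_nonneg c]

theorem norm_le_of_mem_realSkeleton {a b R : ℝ} {x : ℂ × ℂ × ℂ} (hx : x ∈ realSkeleton a b)
    (ha : |a| ≤ R) (hb : |b| ≤ R) : ‖x‖ ≤ 2 * R := by
  obtain ⟨⟨hv, hs⟩, him, hre⟩ := hx
  have hy : ‖x.1‖ ≤ R := by
    rw [← Complex.abs_re_eq_norm.2 him]
    exact hre.trans (max_le ((le_abs_self a).trans ha) ((le_abs_self b).trans hb))
  have hR : 0 ≤ R := (abs_nonneg a).trans ha
  refine max_le (by linarith) (max_le ?_ ?_)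
  · exact norm_le_of_sq_add_sq_eq_sq hv hy (by simpa using ha)
  · exact norm_le_of_sq_add_sq_eq_sq hs hy (by simpa using hb)

theorem isClosed_setOf_mem_realSkeleton (b : ℝ) :
    IsClosed {z : ℝ × ℂ × ℂ × ℂ | z.2 ∈ realSkeleton z.1 b} :=
  have hle : IsClosed {z : ℝ × ℂ × ℂ × ℂ | |z.2.1.re| ≤ max z.1 b} :=
    isClosed_le (by fun_prop) (by fun_prop)
  ((isClosed_eq (by fun_prop) (by fun_prop)).inter (isClosed_eq (by fun_prop) (by fun_prop))).inter
    ((isClosed_eq (by fun_prop) (by fun_prop)).inter hle)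

theorem isCompact_setOf_mem_realSkeleton {T : Set ℝ} (hT : IsCompact T) (b : ℝ) :
    IsCompact {z : ℝ × ℂ × ℂ × ℂ | z.1 ∈ T ∧ z.2 ∈ realSkeleton z.1 b} := by
  obtain ⟨R, hR⟩ := hT.isBounded.exists_norm_le
  refine (hT.prod (isCompact_closedBall (0 : ℂ × ℂ × ℂ) (2 * max R |b|))).of_isClosed_subset
    ((hT.isClosed.preimage continuous_fst).inter (isClosed_setOf_mem_realSkeleton b)) ?_
  rintro ⟨a, x⟩ ⟨ha, hx⟩
  exact ⟨ha, mem_closedBall_zero_iff.2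
    (norm_le_of_mem_realSkeleton hx ((hR a ha).trans (le_max_left _ _)) (le_max_right _ _))⟩

theorem eventually_embed_image_realSkeleton_subset {C : ℝ} (hC : C ≠ 1) {ξ : ℝ} {V : Set State}
    (hV : IsOpen V) (hΩ : omegaSet C ξ ⊆ V) :
    ∀ᶠ k in 𝓝 (1 : ℝ), embed C '' realSkeleton k 1 ⊆ V := by
  have hone : ∀ x, ((1 : ℝ), x) ∈ {z : ℝ × ℂ × ℂ × ℂ | z.1 ∈ Metric.closedBall 1 1 ∧
      z.2 ∈ realSkeleton z.1 1} → x ∈ embed C ⁻¹' V := fun x hx =>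
    hΩ (embed_image_realSkeleton_subset_omegaSet hC ξ (Set.mem_image_of_mem _ hx.2))
  filter_upwards [Metric.closedBall_mem_nhds (1 : ℝ) one_pos, eventually_forall_mem_of_isCompact
    (isCompact_setOf_mem_realSkeleton (isCompact_closedBall 1 1) 1)
    (hV.preimage (continuous_embed C)) hone] with k hk hkV
  exact Set.image_subset_iff.2 fun x hx => hkV x ⟨hk, hx⟩

theorem embed_image_realSkeleton_subset_surfacePi (C k : ℝ) :
    embed C '' realSkeleton k 1 ⊆ surfacePi :=
  Set.image_subset_iff.2 fun _ hx => embed_mem_surfacePi C hx.1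

end NearModulusOne

theorem mainTheorem7_general (C ξ : ℝ) (_hC0 : C ≠ 0) (hC1 : C ≠ 1) (U : Set State)
    (hU : IsNeighbourhoodInPi U (omegaSet C ξ)) :
    ∃ ε : ℝ, 0 < ε ∧ ∀ k : ℝ, 0 < |k - 1| → |k - 1| < ε → GeneratedByLoopsIn (Gam C ξ k) U := by
  obtain ⟨-, V, hV, hΩ, hVU⟩ := hU
  obtain ⟨ε, hε, hnear⟩ := Metric.eventually_nhds_iff.1
    ((eventually_embed_image_realSkeleton_subset hC1 hV hΩ).and (lt_mem_nhds one_pos))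
  refine ⟨ε, hε, fun k hk₁ hkε => ?_⟩
  obtain ⟨hkV, hk₀⟩ := hnear hkε
  exact generatedByLoopsIn_gam hC1 hk₀ (sub_ne_zero.1 (abs_pos.1 hk₁))
    ((Set.subset_inter hkV (embed_image_realSkeleton_subset_surfacePi C k)).trans hVU)

end Satellite

theorem mainTheorem7 (C ξ : ℝ) (hC0 : 0 < C) (hC1 : C ≠ 1) (U : Set Satellite.State)
    (hU : Satellite.IsNeighbourhoodInPi U (Satellite.omegaSet C ξ)) :
    ∃ ε : ℝ, 0 < ε ∧ ∀ k : ℝ, 0 < |k - 1| → |k - 1| < ε →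
      Satellite.GeneratedByLoopsIn (Satellite.Gam C ξ k) U :=
  Satellite.mainTheorem7_general C ξ hC0.ne' hC1 U hU
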